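/- Let $\mathbb k$ be an algebraically closed field of characteristic zero and let $\mathfrak g$ be a finite-dimensional simple Lie algebra over $\mathbb k$. Let $\mathfrak g=\bigoplus_{i\in\mathbb Z}\mathfrak g(i)$ be a short $\mathbb Z$-grading, i.e. $\mathfrak g=\mathfrak g(-1)\oplus\mathfrak g(0)\oplus\mathfrak g(1)$ with $\mathfrak g(1)\neq 0$. Let $\mathfrak t$ be a Cartan subalgebra of $\mathfrak g$ contained in $\mathfrak g(0)$, and let $\Pi$ be a set of simple roots of $(\mathfrak g,\mathfrak t)$ such that every $\alpha\in\Pi$ has non-negative degree (that is, its root space lies in $\mathfrak g(i)$ for some $i\ge 0$); let $\Pi(0)\subset\Pi$ be the subset of simple roots of degree $0$. Let $\Delta(1)$ be the set of $\mathfrak t$-weights in $\mathfrak g(1)$, ordered by the root order of $\mathfrak g(0)$ (the partial order generated by the relations $\nu\preccurlyeq\mu$ for $\mu-\nu\in\Pi(0)$), and let $\mathcal E(1)$ be the set of edges of its Hasse diagram, i.e. the set of pairs $(\mu,\nu)\in\Delta(1)\times\Delta(1)$ such that $\mu$ covers $\nu$. Let $h=\mathrm{ht}(\theta)+1$ be the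 Coxeter number of $\mathfrak g$, where $\theta$ is the highest root and the height of a root is the sum of its coefficients with respect to $\Pi$. Then $$2\dim\mathfrak g(1)-\#\mathcal E(1)=h.$$ -/

import Mathlib

/-- The set of weights of `H` in a subspace `V` of `L`: the linear forms `χ` on `H` for which `V`
contains a nonzero simultaneous eigenvector of `H` with eigenvalue `χ`. -/
def weightSet {k L : Type*} [Field k] [LieRing L] [LieAlgebra k L]
    (H : LieSubalgebra k L) (V : Submodule k L) : Set (Module.Dual k H) :=
  {χ | ∃ x ∈ V, x ≠ 0 ∧ ∀ y : H, ⁅(y : L), x⁆ = χ y • x}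

/-- The root order on a set `P` of weights, with respect to a set `S` of simple roots:
`RootLE S P ν μ` (that is, `ν ≼ μ`) if `μ` is reached from `ν` inside `P` by successively adding
elements of `S`. -/
def RootLE {M : Type*} [AddCommGroup M] (S P : Set M) : P → P → Prop :=
  Relation.ReflTransGen fun ν μ => (μ : M) - (ν : M) ∈ S

/-- The edges of the Hasse diagram of an order `le`: the pairs `(μ, ν)` such that `μ` covers `ν`. -/
def hasseEdges {X : Type*} (le : X → X → Prop) : Set (X × X) :=
  {p | p.1 ≠ p.2 ∧ le p.2 p.1 ∧ ∀ γ, le p.2 γ → le γ p.1 → γ = p.1 ∨ γ = p.2}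

/-- If some additive function takes the value `1` on `S` (for instance, if `S` is linearly
independent), then in the root order `μ` covers `ν` if and only if `μ - ν` belongs to `S`. -/
theorem mem_hasseEdges_rootLE_iff {M R : Type*} [AddCommGroup M] [Ring R] [CharZero R]
    (S P : Set M) (f : M →+ R) (hf : ∀ α ∈ S, f α = 1) (μ ν : P) :
    (μ, ν) ∈ hasseEdges (RootLE S P) ↔ (μ : M) - (ν : M) ∈ S := by
  have key : ∀ a b : P, RootLE S P a b → ∃ n : ℕ, f b = f a + n ∧ (n = 0 → a = b) := by
    intro a b hab
    induction hab with
    | refl => exact ⟨0, by simp, fun _ => rfl⟩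
    | tail _ hbc ih =>
      obtain ⟨n, hn, -⟩ := ih
      have h1 := hf _ hbc
      rw [map_sub, sub_eq_iff_eq_add, hn] at h1
      refine ⟨n + 1, ?_, by simp⟩
      rw [h1]
      push_cast
      abel
  constructor
  · rintro ⟨hne, hle, hcov⟩
    simp only at hne hle hcov
    rcases Relation.ReflTransGen.cases_tail hle with h | ⟨c, hνc, hcμ⟩
    · exact absurd h hne
    · rcases hcov c hνc (Relation.ReflTransGen.single hcμ) with rfl | rfl
      · have := hf _ hcμ
        simp at this
      · exact hcμ
  · intro h
    have h1 : f μ = f ν + 1 := by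
      have := hf _ h
      rw [map_sub, sub_eq_iff_eq_add] at this
      rw [this, add_comm]
    refine ⟨?_, Relation.ReflTransGen.single h, ?_⟩
    · rintro (rfl : μ = ν)
      simp at h1
    · intro γ h2 h3
      obtain ⟨n, hn, hn0⟩ := key _ _ h2
      obtain ⟨m, hm, hm0⟩ := key _ _ h3
      simp only at hn hm hn0 hm0 ⊢
      rw [hn, h1, add_assoc, add_left_cancel_iff] at hm
      have : 1 = n + m := by exact_mod_cast hm
      rcases Nat.eq_zero_or_pos m with h0 | h0
      · exact Or.inl (hm0 h0)
      · exact Or.inr (hn0 (by omega)).symm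

/-- The Coxeter number `h = ht(θ) + 1` of an irreducible root system with base `b`, where the
highest root `θ` is the root of largest height. (Negative heights are truncated to `0`, which does
not affect the maximum.) -/
noncomputable def coxeterNumber {ι R M N : Type*} [Fintype ι] [CommRing R] [CharZero R]
    [AddCommGroup M] [Module R M] [AddCommGroup N] [Module R N]
    {P : RootPairing ι R M N} (b : P.Base) : ℕ :=
  1 + Finset.univ.sup fun i => (b.height i).toNat

/-- A short `ℤ`-grading: nontrivial, with `L = 𝒢 (-1) ⊕ 𝒢 0 ⊕ 𝒢 1`. -/
def IsShortGrading {k L : Type*} [Field k] [LieRing L] [LieAlgebra k L]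
    (𝒢 : ℤ → Submodule k L) : Prop :=
  𝒢 1 ≠ ⊥ ∧ ∀ i : ℤ, 𝒢 i ≠ ⊥ → i = -1 ∨ i = 0 ∨ i = 1

/-- The simple roots of degree `0`, i.e. the simple roots of `𝒢 0`, as linear forms on the Cartan
subalgebra `H`. -/
def simpleRootsZero {k L : Type*} [Field k] [CharZero k] [IsAlgClosed k]
    [LieRing L] [LieAlgebra k L] [FiniteDimensional k L] [LieAlgebra.IsSimple k L]
    (𝒢 : ℤ → Submodule k L) (H : LieSubalgebra k L) [H.IsCartanSubalgebra]
    (b : (LieAlgebra.IsKilling.rootSystem H).Base) : Set (Module.Dual k H) :=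
  ((LieAlgebra.IsKilling.rootSystem H).root '' (b.support : Set _)) ∩ weightSet H (𝒢 0)

/-- The set `E(i)` of edges of the Hasse diagram of the weight poset of the `𝒢 0`-module `𝒢 i`. -/
def gradingEdges {k L : Type*} [Field k] [CharZero k] [IsAlgClosed k]
    [LieRing L] [LieAlgebra k L] [FiniteDimensional k L] [LieAlgebra.IsSimple k L]
    (𝒢 : ℤ → Submodule k L) (H : LieSubalgebra k L) [H.IsCartanSubalgebra]
    (b : (LieAlgebra.IsKilling.rootSystem H).Base) (i : ℤ) :
    Set (weightSet H (𝒢 i) × weightSet H (𝒢 i)) :=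
  hasseEdges (RootLE (simpleRootsZero 𝒢 H b) (weightSet H (𝒢 i)))

/-! Write `p(α, β)` for `⟨α, β^∨⟩⟨β, α^∨⟩` and `r` for the rank. The proof double counts sums of
`p(α, β)` over roots `β`.

Over all `β` the sum is `4h` for every root `α`: irreducibility makes it independent of `α`
(`sum_pairing_mul_pairing_eq`), and at the highest root it is `4(ht θ + 1)`. If `s` is a set of
roots stable under the simple reflections in `I` and supported on `I`, computing a trace in two ways
gives `∑_{α ∈ I} ∑_{β ∈ s} p(α, β) = 4 #s` (`Base.sum_sum_pairing_mul_pairing`). With all roots this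
reads `#Δ = h r`; with `Δ(0)` and `Π(0)` it gives `4 #Δ(0)`.

For `α ∈ Π(0)` the sum over `Δ(1)` is twice the number of Hasse edges labelled `α`
(`sum_degree_one_pairingIn_mul_pairingIn`). Since `θ` has full support and degree at most `1`,
`#Π(0) = r - 1`. Summing `4h` over `Π(0)`, with `Δ(±1)` contributing equally, yields `h(r - 1) =
#Δ(0) + #E(1)`; subtract this from `h r = #Δ(0) + 2 #Δ(1)`. -/

namespace RootPairing

open Module Finset

/-! ### Root-coroot sums and their traces -/

section RootCorootSum

variable {ι k M N : Type*} [Field k] [AddCommGroup M] [Module k M] [AddCommGroup N] [Module k N]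
  (P : RootPairing ι k M N)

/-- The endomorphism `x ↦ ∑ j ∈ s, ⟨x, αⱼ^∨⟩ αⱼ` attached to a finite set `s` of roots. -/
noncomputable def rootCorootSum (s : Finset ι) : M →ₗ[k] M :=
  ∑ j ∈ s, (P.coroot' j).smulRight (P.root j)

lemma rootCorootSum_apply (s : Finset ι) (x : M) :
    P.rootCorootSum s x = ∑ j ∈ s, P.coroot' j x • P.root j := by
  simp [rootCorootSum, LinearMap.sum_apply]

/-- Reindexing by the reflection in `αᵢ` negates both pairings and replaces `αⱼ` by its reflection,
so the image `y` of `αᵢ` satisfies `y = -y + c αᵢ`: `αᵢ` is an eigenvector. -/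
lemma two_smul_rootCorootSum_root (s : Finset ι) (i : ι)
    (hs : ∀ j ∈ s, P.reflectionPerm i j ∈ s) :
    (2 : k) • P.rootCorootSum s (P.root i) =
      (∑ j ∈ s, P.pairing i j * P.pairing j i) • P.root i := by
  have h : P.rootCorootSum s (P.root i) =
      -P.rootCorootSum s (P.root i) + (∑ j ∈ s, P.pairing i j * P.pairing j i) • P.root i := by
    conv_lhs => rw [rootCorootSum_apply]
    rw [rootCorootSum_apply, ← Finset.sum_neg_distrib, Finset.sum_smul, ← Finset.sum_add_distrib]
    refine Finset.sum_nbij' (P.reflectionPerm i) (P.reflectionPerm i) hs hs (by simp) (by simp) ?_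
    intro j hj
    have h1 : P.pairing i (P.reflectionPerm i j) = -P.pairing i j := by
      rw [pairing_reflectionPerm, pairing_reflectionPerm_self_left]
    have h2 : P.pairing (P.reflectionPerm i j) i = -P.pairing j i := by
      rw [← pairing_reflectionPerm, pairing_reflectionPerm_self_right]
    rw [root_reflectionPerm, reflection_apply_root, root_coroot'_eq_pairing,
      root_coroot'_eq_pairing, h1, h2]
    module
  rw [two_smul]
  nth_rewrite 1 [h]
  abel

lemma trace_rootCorootSum [FiniteDimensional k M] (s : Finset ι) :
    LinearMap.trace k M (P.rootCorootSum s) = 2 * (s.card : k) := by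
  simp [rootCorootSum, LinearMap.trace_smulRight, mul_comm]

lemma rootCorootSum_univ_reflection [Fintype ι] (i : ι) (x : M) :
    P.rootCorootSum univ (P.reflection i x) = P.reflection i (P.rootCorootSum univ x) := by
  simp only [rootCorootSum_apply, map_sum, map_smul]
  refine Fintype.sum_equiv (P.reflectionPerm i) _ _ fun j => ?_
  rw [← root_reflectionPerm, reflectionPerm_self, coroot'_reflectionPerm]
  rfl

/-- In an irreducible root system, the sum `∑ j, ⟨αᵢ, αⱼ^∨⟩⟨αⱼ, αᵢ^∨⟩` does not depend on `i`. -/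
lemma sum_pairing_mul_pairing_eq [Fintype ι] [CharZero k] [P.IsIrreducible] (i i' : ι) :
    ∑ j, P.pairing i j * P.pairing j i = ∑ j, P.pairing i' j * P.pairing j i' := by
  set c := ∑ j, P.pairing i j * P.pairing j i with hc
  -- This eigenspace is invariant under all reflections and contains `αᵢ`, so it is everything.
  let q : Submodule k M :=
    LinearMap.ker ((2 : k) • P.rootCorootSum univ - c • LinearMap.id)
  have hmem (x : M) : x ∈ q ↔ (2 : k) • P.rootCorootSum univ x = c • x := by
    simp [q, sub_eq_zero]
  have hi : P.root i ∈ q := (hmem _).2 (P.two_smul_rootCorootSum_root univ i (by simp))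
  have hq : q = ⊤ := by
    refine IsIrreducible.eq_top_of_invtSubmodule_reflection (P := P) q (fun j x hx => ?_) ?_
    · rw [hmem] at hx
      rw [Submodule.mem_comap, hmem]
      simp only [LinearEquiv.coe_coe]
      rw [rootCorootSum_univ_reflection, ← map_smul, hx, map_smul]
    · intro h
      rw [h] at hi
      exact P.ne_zero i (by simpa using hi)
  have hi' : P.root i' ∈ q := hq ▸ Submodule.mem_top
  rw [hmem, P.two_smul_rootCorootSum_root univ i' (by simp)] at hi'
  exact (smul_left_injective k (P.ne_zero i') hi').symm

/-- Both sides are twice the trace of `P.rootCorootSum s`. Each rank-one summand has trace `2`. In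
the basis of simple roots, the diagonal entry at `i ∈ I` is an eigenvalue, and at `i ∉ I` it
vanishes because the image has no `αᵢ`-coordinate. -/
lemma Base.sum_sum_pairing_mul_pairing {P : RootPairing ι k M N} (b : P.Base) [P.IsRootSystem]
    (s I : Finset ι) (hI : I ⊆ b.support) (hs : ∀ i ∈ I, ∀ j ∈ s, P.reflectionPerm i j ∈ s)
    (h0 : ∀ i : b.support, (i : ι) ∉ I → ∀ j ∈ s, b.toWeightBasis.repr (P.root j) i = 0) :
    ∑ i ∈ I, ∑ j ∈ s, P.pairing i j * P.pairing j i = 4 * (s.card : k) := by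
  classical
  have : FiniteDimensional k M := b.toWeightBasis.finiteDimensional_of_finite
  have h1 : (2 : k) * LinearMap.trace k M (P.rootCorootSum s) =
      ∑ i : b.support, if (i : ι) ∈ I then ∑ j ∈ s, P.pairing i j * P.pairing j i else 0 := by
    rw [LinearMap.trace_eq_matrix_trace k b.toWeightBasis, Matrix.trace, Finset.mul_sum]
    refine Finset.sum_congr rfl fun i _ => ?_
    rw [Matrix.diag_apply, LinearMap.toMatrix_apply, Base.toWeightBasis_apply]
    split_ifs with hi
    · have := congrArg (fun x => b.toWeightBasis.repr x i)
        (P.two_smul_rootCorootSum_root s i (hs i hi))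
      simpa using this
    · rw [rootCorootSum_apply]
      simp only [map_sum, map_smul, Finsupp.coe_finsetSum, Finset.sum_apply, Finsupp.smul_apply]
      rw [Finset.sum_eq_zero fun j hj => by rw [h0 i hi j hj, smul_zero], mul_zero]
  rw [trace_rootCorootSum, Finset.sum_coe_sort b.support
    (fun i => if i ∈ I then ∑ j ∈ s, P.pairing i j * P.pairing j i else 0),
    ← Finset.sum_filter, Finset.filter_mem_eq_inter, Finset.inter_eq_right.2 hI] at h1
  rw [← h1]
  ring

end RootCorootSum

end RootPairing

namespace RootPairing

open Module Finset

/-! ### Heights and the highest root -/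

section Height

variable {ι k M N : Type*} [Field k] [CharZero k] [AddCommGroup M] [Module k M]
  [AddCommGroup N] [Module k N]
  {P : RootPairing ι k M N} [P.IsCrystallographic]

lemma pairingIn_reflectionPerm_right (i j : ι) :
    P.pairingIn ℤ i (P.reflectionPerm i j) = -P.pairingIn ℤ i j := by
  rw [pairingIn_reflectionPerm, pairingIn_reflectionPerm_self_left]

lemma pairingIn_reflectionPerm_left (i j : ι) :
    P.pairingIn ℤ (P.reflectionPerm i j) i = -P.pairingIn ℤ j i := by
  rw [← pairingIn_reflectionPerm, pairingIn_reflectionPerm_self_right]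

omit [CharZero k] in
lemma root_reflectionPerm_eq_sub_zsmul (i j : ι) :
    P.root (P.reflectionPerm i j) = P.root j - P.pairingIn ℤ j i • P.root i := by
  rw [root_reflectionPerm, reflection_apply_root' ℤ]

lemma Base.height_reflectionPerm (b : P.Base) (i j : ι) :
    b.height (P.reflectionPerm i j) = b.height j - P.pairingIn ℤ j i * b.height i := by
  have h : P.root (P.reflectionPerm i j) = P.root j + (-P.pairingIn ℤ j i) • P.root i := by
    rw [root_reflectionPerm_eq_sub_zsmul]; module
  rw [b.height_add_zsmul h, smul_eq_mul]
  ring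

lemma Base.height_reflectionPerm_same (b : P.Base) (i : ι) :
    b.height (P.reflectionPerm i i) = -b.height i := by
  simp [Base.height_reflectionPerm]
  ring

lemma pairingIn_eq_sum_of_root_eq_sum {s : Finset ι} {i : ι} {f : ι → ℤ}
    (h : P.root i = ∑ l ∈ s, f l • P.root l) (j : ι) :
    P.pairingIn ℤ i j = ∑ l ∈ s, f l * P.pairingIn ℤ l j := by
  refine FaithfulSMul.algebraMap_injective ℤ k ?_
  have := congrArg (P.coroot' j) h
  simp_rw [map_sum, map_mul, algebraMap_pairingIn]
  simpa [root_coroot'_eq_pairing] using this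

variable [Fintype ι]

/-- A simple reflection permutes the positive roots other than `αᵢ` and negates their pairings with
`αᵢ`, so only the term `⟨αᵢ, αᵢ^∨⟩` survives. -/
lemma Base.sum_pos_pairingIn_of_mem_support [P.IsReduced] (b : P.Base) {i : ι}
    (hi : i ∈ b.support) :
    ∑ j with 0 < b.height j, P.pairingIn ℤ i j = 2 := by
  classical
  have hi' : i ∈ univ.filter fun j => 0 < b.height j := by
    simp [Base.height_one_of_mem_support hi]
  rw [← Finset.add_sum_erase _ _ hi', pairingIn_same, add_eq_left]
  refine Finset.sum_involution (fun j _ => P.reflectionPerm i j) ?_ ?_ ?_ (by simp)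
  · intro j _
    rw [pairingIn_reflectionPerm_right, add_neg_cancel]
  · intro j _ h h'
    have := pairingIn_reflectionPerm_right (P := P) i j
    rw [h'] at this
    omega
  · intro j hj
    rw [Finset.mem_erase, Finset.mem_filter] at hj ⊢
    refine ⟨fun h => ?_, mem_univ _, Base.IsPos.reflectionPerm hj.2.2 hi hj.1⟩
    have h1 := hj.2.2
    rw [← P.reflectionPerm_self i j, h, Base.height_reflectionPerm_same,
      Base.height_one_of_mem_support hi] at h1
    omega

/-- The sum of all positive coroots pairs with a root `α` to twice the height of `α`. -/
lemma Base.sum_pos_pairingIn [P.IsReduced] (b : P.Base) (i : ι) :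
    ∑ j with 0 < b.height j, P.pairingIn ℤ i j = 2 * b.height i := by
  obtain ⟨f, -, -, hf⟩ := b.exists_root_eq_sum_int i
  rw [Base.height_eq_sum hf, Finset.mul_sum]
  simp_rw [pairingIn_eq_sum_of_root_eq_sum hf]
  rw [Finset.sum_comm]
  refine Finset.sum_congr rfl fun l hl => ?_
  rw [← Finset.mul_sum, b.sum_pos_pairingIn_of_mem_support hl, mul_comm]

lemma Base.pairingIn_nonneg_of_height_max (b : P.Base) {i j : ι}
    (hmax : ∀ l, b.height l ≤ b.height i) (hj : 0 < b.height j) :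
    0 ≤ P.pairingIn ℤ i j := by
  by_contra! h
  have hi := (hj.trans_le (hmax j))
  obtain ⟨l, hl⟩ := P.root_add_root_mem_of_pairingIn_neg h (fun h' => by
    have : P.root i = P.root (P.reflectionPerm j j) := by simpa using h'
    rw [P.root.injective this, Base.height_reflectionPerm_same] at hi
    omega)
  have := b.height_add hl
  have := hmax l
  omega

/-- If `n = ⟨β, θ^∨⟩ ≥ 2`, the root `nθ - β` has height above `ht θ`, because `ht β < ht θ`. -/
lemma Base.pairingIn_le_one_of_height_max (b : P.Base) {i j : ι}
    (hmax : ∀ l, b.height l ≤ b.height i) (hj : 0 < b.height j) (hij : j ≠ i) :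
    P.pairingIn ℤ j i ≤ 1 := by
  by_contra! h
  have h1 := hmax (P.reflectionPerm (P.reflectionPerm i j) (P.reflectionPerm i j))
  rw [Base.height_reflectionPerm_same, Base.height_reflectionPerm] at h1
  obtain ⟨l, hl⟩ := P.root_sub_root_mem_of_pairingIn_pos (by omega) hij
  have h2 := b.height_sub hl
  have h3 := b.height_ne_zero l
  have h4 : b.height j < b.height i := by
    have := hmax j
    omega
  nlinarith [mul_nonneg (show 0 ≤ P.pairingIn ℤ j i - 2 by omega) (hj.trans h4).le]

lemma sum_pos_eq_two_mul_of_even (b : P.Base) (g : ι → ℤ)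
    (hg : ∀ j, g (P.reflectionPerm j j) = g j) :
    ∑ j, g j = 2 * ∑ j with 0 < b.height j, g j := by
  rw [← Finset.sum_filter_add_sum_filter_not univ fun j => 0 < b.height j, two_mul]
  congr 1
  have hs : ∀ j, P.reflectionPerm (P.reflectionPerm j j) (P.reflectionPerm j j) = j := by
    intro j
    apply P.root.injective
    rw [root_reflectionPerm, reflection_apply_self, root_reflectionPerm, reflection_apply_self,
      neg_neg]
  refine Finset.sum_nbij' (fun j => P.reflectionPerm j j) (fun j => P.reflectionPerm j j)
    ?_ ?_ (fun j _ => hs j) (fun j _ => hs j) (fun j _ => (hg j).symm)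
  all_goals
    intro j hj
    have := b.height_ne_zero j
    simp only [mem_filter, mem_univ, true_and, Base.height_reflectionPerm_same] at hj ⊢
    omega

/-- For positive `β ≠ θ`, `⟨β, θ^∨⟩` is `0` or `1`, so the product is just `⟨θ, β^∨⟩`. These add up
to `2 ht θ - 2`, and `β = θ` adds `4`; negative roots double the total. -/
lemma Base.sum_pairingIn_mul_pairingIn_of_height_max [P.IsReduced] (b : P.Base) {i : ι}
    (hmax : ∀ l, b.height l ≤ b.height i) :
    ∑ j, P.pairingIn ℤ i j * P.pairingIn ℤ j i = 4 * (b.height i + 1) := by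
  classical
  have hpos : 0 < b.height i := by
    have h1 := hmax (P.reflectionPerm i i)
    have h2 := b.height_ne_zero i
    rw [Base.height_reflectionPerm_same] at h1
    omega
  have hi : i ∈ univ.filter fun j => 0 < b.height j := by simpa
  have h := b.sum_pos_pairingIn i
  rw [sum_pos_eq_two_mul_of_even b _ (by simp)]
  rw [← Finset.add_sum_erase _ _ hi, pairingIn_same] at h ⊢
  have : ∑ j ∈ (univ.filter fun j => 0 < b.height j).erase i,
      P.pairingIn ℤ i j * P.pairingIn ℤ j i =
      ∑ j ∈ (univ.filter fun j => 0 < b.height j).erase i, P.pairingIn ℤ i j := by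
    refine Finset.sum_congr rfl fun j hj => ?_
    simp only [mem_erase, mem_filter, mem_univ, true_and] at hj
    have h1 := b.pairingIn_nonneg_of_height_max hmax hj.2
    have h2 := b.pairingIn_le_one_of_height_max hmax hj.2 hj.1
    rcases h1.eq_or_lt with h0 | h0
    · rw [← h0, zero_mul]
    · have := (P.zero_lt_pairingIn_iff' ℤ).1 h0
      rw [show P.pairingIn ℤ j i = 1 by omega, mul_one]
  rw [this]
  linarith

lemma coxeterNumber_eq_of_height_max (b : P.Base) {i : ι}
    (hmax : ∀ l, b.height l ≤ b.height i) :
    (coxeterNumber b : ℤ) = b.height i + 1 := by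
  have hpos : 0 ≤ b.height i := by
    have h1 := hmax (P.reflectionPerm i i)
    rw [Base.height_reflectionPerm_same] at h1
    omega
  have : (univ.sup fun i => (b.height i).toNat) = (b.height i).toNat :=
    le_antisymm (Finset.sup_le fun l _ => Int.toNat_le_toNat (hmax l))
      (Finset.le_sup (f := fun i => (b.height i).toNat) (mem_univ i))
  rw [coxeterNumber, this]
  push_cast
  rw [Int.toNat_of_nonneg hpos, add_comm]

/-- The highest root of an irreducible root system has full support. -/
lemma Base.exists_root_eq_sum_pos_of_height_max [P.IsReduced] [P.IsIrreducible] (b : P.Base) {i : ι}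
    (hmax : ∀ l, b.height l ≤ b.height i) :
    ∃ f : ι → ℤ, (∀ j ∈ b.support, 0 < f j) ∧ P.root i = ∑ j ∈ b.support, f j • P.root j := by
  obtain ⟨f, hf0, hf1, hf⟩ := b.exists_root_eq_sum_int i
  have hpos : 0 < b.height i := by
    have h1 := hmax (P.reflectionPerm i i)
    have h2 := b.height_ne_zero i
    rw [Base.height_reflectionPerm_same] at h1
    omega
  have hf1 : 0 < f := by
    refine hf1.resolve_right fun h => ?_
    rw [Base.height_eq_sum hf] at hpos
    exact absurd (Finset.sum_nonpos fun j _ => h.le j) (not_le.2 hpos)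
  refine ⟨f, fun j hj => ?_, hf⟩
  by_contra hj0
  have hj0 : f j = 0 := le_antisymm (not_lt.1 hj0) (hf1.le j)
  -- `⟨θ, αₘ^∨⟩ ≥ 0` is a sum of nonpositive terms when `αₘ` is missing from `θ`, so every term
  -- vanishes. The simple roots occurring in `θ` then span a reflection-invariant subspace.
  have key : ∀ l ∈ b.support, f l ≠ 0 → ∀ m ∈ b.support, f m = 0 → P.pairing l m = 0 := by
    intro l hl hfl m hm hfm
    have h1 := b.pairingIn_nonneg_of_height_max hmax
      (j := m) (by rw [Base.height_one_of_mem_support hm]; exact one_pos)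
    rw [pairingIn_eq_sum_of_root_eq_sum hf] at h1
    have h2 : ∀ l ∈ b.support, f l * P.pairingIn ℤ l m ≤ 0 := by
      intro l hl
      by_cases hlm : l = m
      · rw [hlm, hfm, zero_mul]
      · exact mul_nonpos_of_nonneg_of_nonpos (hf1.le l) (b.pairingIn_le_zero_of_ne hlm hl hm)
    have h3 := (Finset.sum_eq_zero_iff_of_nonpos h2).1 (le_antisymm (Finset.sum_nonpos h2) h1) l hl
    rw [← P.algebraMap_pairingIn ℤ, (mul_eq_zero.1 h3).resolve_left hfl, map_zero]
  let q : Submodule k M := Submodule.span k (P.root '' {l | l ∈ b.support ∧ f l ≠ 0})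
  have hker : ∀ m ∈ b.support, f m = 0 → q ≤ LinearMap.ker (P.coroot' m) := by
    intro m hm hfm
    rw [Submodule.span_le]
    rintro - ⟨l, ⟨hl, hfl⟩, rfl⟩
    simpa [root_coroot'_eq_pairing] using key l hl hfl m hm hfm
  have hq : q = ⊤ := by
    refine IsIrreducible.eq_top_of_invtSubmodule_reflection (P := P) q
      ((b.forall_mem_support_invtSubmodule_iff q).1 fun m hm x hx => ?_) ?_
    · rw [Submodule.mem_comap, LinearEquiv.coe_coe, reflection_apply]
      by_cases hfm : f m = 0
      · rw [LinearMap.mem_ker.1 (hker m hm hfm hx), zero_smul, sub_zero]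
        exact hx
      · exact q.sub_mem hx (q.smul_mem _ (Submodule.subset_span ⟨m, ⟨hm, hfm⟩, rfl⟩))
    · intro h
      have hi : P.root i ∈ q := by
        rw [hf]
        refine q.sum_mem fun l hl => ?_
        by_cases hfl : f l = 0
        · simp [hfl]
        · exact zsmul_mem (Submodule.subset_span (s := P.root '' {l | l ∈ b.support ∧ f l ≠ 0})
            ⟨l, ⟨hl, hfl⟩, rfl⟩) _
      rw [h] at hi
      exact P.ne_zero i (by simpa using hi)
  have := hker j hj hj0 (hq ▸ Submodule.mem_top : P.root j ∈ q)
  simp at this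

end Height

end RootPairing

namespace RootPairing

open Module Finset

/-! ### Short gradings of root systems -/

section Degree

variable {ι k M N : Type*} [Field k] [CharZero k] [AddCommGroup M] [Module k M]
  [AddCommGroup N] [Module k N]
  {P : RootPairing ι k M N} [P.IsCrystallographic] {f : Module.Dual k M} {d : ι → ℤ}

lemma degree_reflectionPerm (hd : ∀ j, f (P.root j) = d j) (i j : ι) :
    d (P.reflectionPerm i j) = d j - P.pairingIn ℤ j i * d i := by
  have h := hd (P.reflectionPerm i j)
  rw [root_reflectionPerm_eq_sub_zsmul, map_sub, map_zsmul, hd, hd] at h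
  have : ((d (P.reflectionPerm i j) : ℤ) : k) = ((d j - P.pairingIn ℤ j i * d i : ℤ) : k) := by
    rw [← h]
    simp [-algebraMap_pairingIn', -algebraMap_pairingIn]
  exact_mod_cast this

omit [P.IsCrystallographic] in
lemma degree_of_root_eq_sub (hd : ∀ j, f (P.root j) = d j) {i j l : ι}
    (h : P.root l = P.root j - P.root i) : d l = d j - d i := by
  have h := congrArg f h
  rw [map_sub, hd, hd, hd] at h
  exact_mod_cast h

lemma pairingIn_of_root_eq_sub {i j l : ι} (h : P.root l = P.root j - P.root i) (m : ι) :
    P.pairingIn ℤ l m = P.pairingIn ℤ j m - P.pairingIn ℤ i m := by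
  have := pairingIn_eq_add_of_root_eq_smul_add_smul (P := P) (S := ℤ) (j := m) (x := 1) (y := -1)
    (show P.root l = (1 : ℤ) • P.root j + (-1 : ℤ) • P.root i by rw [h]; module)
  rw [this]
  simp [sub_eq_add_neg]

variable [Fintype ι]

/-- If all degrees are at most `1` in absolute value, the pairings of a root of degree `0` with a
root of degree `1` are restricted. -/
lemma pairingIn_cases_of_degree (hd : ∀ j, f (P.root j) = d j) (hd1 : ∀ j, |d j| ≤ 1) {i j : ι}
    (hi : d i = 0) (hj : d j = 1) :
    |P.pairingIn ℤ j i| ≤ 2 ∧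
      P.pairingIn ℤ i j * P.pairingIn ℤ j i = |P.pairingIn ℤ j i| := by
  -- With `p = ⟨αⱼ, αᵢ^∨⟩` and `q = ⟨αᵢ, αⱼ^∨⟩`, the roots `sⱼαᵢ` and `sⱼsᵢαⱼ` have degrees `-q` and
  -- `pq - 1`. Hence `|q| ≤ 1` and `pq ≤ 2`.
  have h1 := degree_reflectionPerm hd j i
  have h2 := degree_reflectionPerm hd j (P.reflectionPerm i j)
  have h3 := degree_reflectionPerm hd i j
  have h4 : P.pairingIn ℤ (P.reflectionPerm i j) j =
      2 - P.pairingIn ℤ j i * P.pairingIn ℤ i j := by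
    have := pairingIn_eq_add_of_root_eq_smul_add_smul (P := P) (S := ℤ) (j := j) (x := 1)
      (y := -P.pairingIn ℤ j i) (show P.root (P.reflectionPerm i j) = (1 : ℤ) • P.root j +
        (-P.pairingIn ℤ j i) • P.root i by rw [root_reflectionPerm_eq_sub_zsmul]; module)
    rw [this, pairingIn_same]
    simp [sub_eq_add_neg]
  rw [hi, hj] at h1 h3
  rw [h3, h4, hj] at h2
  have h5 := abs_le.1 (hd1 (P.reflectionPerm j i))
  have h6 := abs_le.1 (hd1 (P.reflectionPerm j (P.reflectionPerm i j)))
  rw [h1] at h5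
  rw [h2] at h6
  rcases lt_trichotomy (P.pairingIn ℤ j i) 0 with h | h | h
  · have h' := (P.pairingIn_lt_zero_iff ℤ).1 h
    have hc : P.pairingIn ℤ i j = -1 := by omega
    rw [abs_of_neg h, hc]
    rw [hc] at h6
    constructor <;> omega
  · simp [h]
  · have h' := (P.zero_lt_pairingIn_iff' ℤ).1 h
    have hc : P.pairingIn ℤ i j = 1 := by omega
    rw [abs_of_pos h, hc]
    rw [hc] at h6
    constructor <;> omega

-- Sort the roots `β` of degree `1` by `p = ⟨β, αᵢ^∨⟩ ∈ {-2, …, 2}`. The product is `|p|`, and `sᵢ`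
-- exchanges `p` with `-p`, so the sum is `2(N₁ + 2N₂)`. Subtracting `αᵢ` always gives a root if `p
-- > 0` and never if `p < 0`; the cases with `p = 0` are the middles of strings `β, β - αᵢ, β -
-- 2αᵢ`, numbering `N₂`.
open Classical in
lemma sum_degree_one_pairingIn_mul_pairingIn (hd : ∀ j, f (P.root j) = d j)
    (hd1 : ∀ j, |d j| ≤ 1) {i : ι} (hi : d i = 0) :
    ∑ j with d j = 1, P.pairingIn ℤ i j * P.pairingIn ℤ j i =
      2 * (#{j | d j = 1 ∧ P.root j - P.root i ∈ Set.range P.root} : ℤ) := by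
  have hσ : ∀ j, d (P.reflectionPerm i j) = d j := fun j => by
    rw [degree_reflectionPerm hd, hi, mul_zero, sub_zero]
  have hneg : ∀ n : ℤ, #{j | d j = 1 ∧ P.pairingIn ℤ j i = -n} =
      #{j | d j = 1 ∧ P.pairingIn ℤ j i = n} := by
    intro n
    refine Finset.card_nbij' (P.reflectionPerm i) (P.reflectionPerm i) ?_ ?_
      (fun j _ => by simp) (fun j _ => by simp)
    all_goals
      intro j hj
      simp only [coe_filter, mem_univ, true_and, Set.mem_ofPred_eq, hσ,
        pairingIn_reflectionPerm_left] at hj ⊢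
      omega
  have hsub : ∀ j l, d j = 1 → P.root l = P.root j - P.root i →
      d l = 1 ∧ P.pairingIn ℤ l i = P.pairingIn ℤ j i - 2 := by
    intro j l hj hl
    rw [degree_of_root_eq_sub hd hl, pairingIn_of_root_eq_sub hl, pairingIn_same]
    omega
  have hne : ∀ j, d j = 1 → j ≠ i := by
    rintro j hj rfl
    omega
  have hzero : #{j | d j = 1 ∧ P.pairingIn ℤ j i = 2} =
      #{j | d j = 1 ∧ P.pairingIn ℤ j i = 0 ∧ P.root j - P.root i ∈ Set.range P.root} := by
    have hex : ∀ j ∈ univ.filter fun j => d j = 1 ∧ P.pairingIn ℤ j i = 2,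
        P.root j - P.root i ∈ Set.range P.root := by
      intro j hj
      simp only [mem_filter, mem_univ, true_and] at hj
      exact P.root_sub_root_mem_of_pairingIn_pos (by omega) (hne j hj.1)
    choose g hg using hex
    refine Finset.card_bij g ?_ ?_ ?_
    · intro j hj
      have h1 := hg j hj
      simp only [mem_filter, mem_univ, true_and] at hj ⊢
      have h2 := hsub j _ hj.1 h1
      refine ⟨h2.1, by omega, P.reflectionPerm i j, ?_⟩
      rw [root_reflectionPerm_eq_sub_zsmul, h1, hj.2]
      module
    · intro j hj j' hj' h
      have h1 := hg j hj
      rw [h, hg j' hj'] at h1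
      exact P.root.injective (sub_left_injective h1).symm
    -- Reflecting `αₗ - αᵢ` gives the top `αₗ + αᵢ` of the string.
    · intro l hl
      simp only [mem_filter, mem_univ, true_and] at hl
      obtain ⟨hl1, hl2, m, hm⟩ := hl
      have h1 := hsub l m hl1 hm
      have h3 : P.root (P.reflectionPerm i m) = P.root l + P.root i := by
        rw [root_reflectionPerm_eq_sub_zsmul, h1.2, hl2, hm]
        module
      have h4 : P.reflectionPerm i m ∈ univ.filter fun j => d j = 1 ∧ P.pairingIn ℤ j i = 2 := by
        simp only [mem_filter, mem_univ, true_and, hσ, pairingIn_reflectionPerm_left]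
        omega
      refine ⟨_, h4, P.root.injective ?_⟩
      rw [hg _ h4, h3, add_sub_cancel_right]
  have hE : #{j | d j = 1 ∧ P.root j - P.root i ∈ Set.range P.root} =
      #{j | d j = 1 ∧ P.pairingIn ℤ j i = 1} + #{j | d j = 1 ∧ P.pairingIn ℤ j i = 2} +
      #{j | d j = 1 ∧ P.pairingIn ℤ j i = 0 ∧ P.root j - P.root i ∈ Set.range P.root} := by
    simp only [Finset.card_filter, ← Finset.sum_add_distrib]
    refine Finset.sum_congr rfl fun j _ => ?_
    by_cases hj : d j = 1
    · have h1 := abs_le.1 (pairingIn_cases_of_degree hd hd1 hi hj).1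
      have hpos : 0 < P.pairingIn ℤ j i → P.root j - P.root i ∈ Set.range P.root :=
        fun h => P.root_sub_root_mem_of_pairingIn_pos h (hne j hj)
      have hnonneg : P.root j - P.root i ∈ Set.range P.root → 0 ≤ P.pairingIn ℤ j i := by
        rintro ⟨l, hl⟩
        have h2 := hsub j l hj hl
        have h3 := abs_le.1 (pairingIn_cases_of_degree hd hd1 hi h2.1).1
        omega
      by_cases hs : P.root j - P.root i ∈ Set.range P.root
      · have := hnonneg hs
        simp only [hj, hs, and_true, true_and, if_true]
        split_ifs <;> omega
      · have : ¬ 0 < P.pairingIn ℤ j i := fun h => hs (hpos h)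
        simp only [hj, hs, and_false, true_and, if_false]
        split_ifs <;> omega
    · simp [hj]
  have hS : ∑ j with d j = 1, P.pairingIn ℤ i j * P.pairingIn ℤ j i =
      (#{j | d j = 1 ∧ P.pairingIn ℤ j i = 1} : ℤ) + #{j | d j = 1 ∧ P.pairingIn ℤ j i = -1} +
      2 * #{j | d j = 1 ∧ P.pairingIn ℤ j i = 2} + 2 * #{j | d j = 1 ∧ P.pairingIn ℤ j i = -2} := by
    simp only [Finset.card_filter, Finset.sum_filter, Nat.cast_sum, Finset.mul_sum,
      ← Finset.sum_add_distrib]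
    refine Finset.sum_congr rfl fun j _ => ?_
    by_cases hj : d j = 1
    · obtain ⟨h1, h2⟩ := pairingIn_cases_of_degree hd hd1 hi hj
      rw [h2]
      generalize P.pairingIn ℤ j i = a at h1
      rw [abs_le] at h1
      obtain ⟨h1, h3⟩ := h1
      simp only [hj, true_and, if_true]
      interval_cases a <;> simp
    · simp [hj]
  rw [hS, hneg, hneg, hE, ← hzero]
  push_cast
  ring

open Classical in
/-- The identity `2 #Δ(1) - #E(1) = h` for a short grading of an irreducible root system. -/
theorem Base.sum_card_add_coxeterNumber [P.IsReduced] [P.IsIrreducible] (b : P.Base)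
    (hd : ∀ j, f (P.root j) = d j) (hd1 : ∀ j, |d j| ≤ 1) (hb : ∀ i ∈ b.support, 0 ≤ d i)
    (hne : ∃ j, d j = 1) :
    (∑ i ∈ b.support with d i = 0,
      #{j | d j = 1 ∧ P.root j - P.root i ∈ Set.range P.root}) + coxeterNumber b =
      2 * #{j | d j = 1} := by
  have : Nonempty ι := ⟨hne.choose⟩
  obtain ⟨θ, -, hθ⟩ := Finset.exists_max_image univ b.height univ_nonempty
  replace hθ : ∀ l, b.height l ≤ b.height θ := fun l => hθ l (mem_univ l)
  have htotal : ∀ i, ∑ j, P.pairingIn ℤ i j * P.pairingIn ℤ j i = 4 * (coxeterNumber b : ℤ) := by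
    intro i
    rw [coxeterNumber_eq_of_height_max b hθ, ← b.sum_pairingIn_mul_pairingIn_of_height_max hθ]
    have := P.sum_pairing_mul_pairing_eq i θ
    simp only [← P.algebraMap_pairingIn ℤ, ← map_mul, ← map_sum] at this
    exact FaithfulSMul.algebraMap_injective ℤ k this
  have hsum : ∀ s I : Finset ι, I ⊆ b.support → (∀ i ∈ I, ∀ j ∈ s, P.reflectionPerm i j ∈ s) →
      (∀ i : b.support, (i : ι) ∉ I → ∀ j ∈ s, b.toWeightBasis.repr (P.root j) i = 0) →
      ∑ i ∈ I, ∑ j ∈ s, P.pairingIn ℤ i j * P.pairingIn ℤ j i = 4 * (#s : ℤ) := by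
    intro s I h1 h2 h3
    have := b.sum_sum_pairing_mul_pairing s I h1 h2 h3
    simp only [← P.algebraMap_pairingIn ℤ, ← map_mul, ← map_sum] at this
    refine FaithfulSMul.algebraMap_injective ℤ k (this.trans ?_)
    simp
  have hcoord : ∀ (j : ι) (g : ι → ℤ), P.root j = ∑ l ∈ b.support, g l • P.root l →
      d j = ∑ l ∈ b.support, g l * d l := by
    intro j g hg
    have := congrArg f hg
    simp only [map_sum, map_zsmul, hd, zsmul_eq_mul] at this
    exact_mod_cast this
  -- Every simple root has positive coefficient in `θ`, whose degree is at most `1`; and some root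
  -- of degree `1` exists.
  have hone : #{i ∈ b.support | d i = 1} = 1 := by
    refine le_antisymm ?_ (Finset.card_pos.2 ?_)
    · obtain ⟨g, hg, hgθ⟩ := b.exists_root_eq_sum_pos_of_height_max hθ
      have h1 := (abs_le.1 (hd1 θ)).2
      rw [hcoord θ g hgθ] at h1
      have h2 : (#{i ∈ b.support | d i = 1} : ℤ) ≤ ∑ l ∈ b.support, g l * d l := by
        rw [Finset.card_filter, Nat.cast_sum]
        refine Finset.sum_le_sum fun l hl => ?_
        have h3 := hg l hl
        have h4 := hb l hl
        split_ifs with h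
        · rw [h]; push_cast; omega
        · push_cast; positivity
      exact_mod_cast h2.trans h1
    · obtain ⟨j, hj⟩ := hne
      by_contra h
      rw [Finset.not_nonempty_iff_eq_empty, Finset.filter_eq_empty_iff] at h
      obtain ⟨g, -, -, hg⟩ := b.exists_root_eq_sum_int j
      rw [hcoord j g hg, Finset.sum_eq_zero fun l hl => ?_] at hj
      · omega
      · have h1 := h hl
        have h2 := hb l hl
        have h3 := (abs_le.1 (hd1 l)).2
        rw [show d l = 0 by omega, mul_zero]
  have hzero : ∑ i ∈ b.support with d i = 0, ∑ j with d j = 0,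
      P.pairingIn ℤ i j * P.pairingIn ℤ j i = 4 * (#{j | d j = 0} : ℤ) := by
    refine hsum _ _ (Finset.filter_subset _ _) ?_ ?_
    · intro i hi j hj
      simp only [mem_filter, mem_univ, true_and] at hi hj ⊢
      rw [degree_reflectionPerm hd, hi.2, hj, mul_zero, sub_zero]
    · intro i hi j hj
      simp only [mem_filter, mem_univ, true_and, i.2] at hi hj
      obtain ⟨g, -, hg0, hg⟩ := b.exists_root_eq_sum_int j
      have hdi := (hb i i.2).lt_of_ne' hi
      have h1 := hcoord j g hg
      rw [hj] at h1
      -- The coefficients of a root share one sign, so in degree `0` no simple root of positive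
      -- degree occurs.
      have h2 : g i = 0 := by
        rcases hg0 with h | h
        · have h3 := (Finset.sum_eq_zero_iff_of_nonneg fun l hl =>
            mul_nonneg (h.le l) (hb l hl)).1 h1.symm i i.2
          exact (mul_eq_zero.1 h3).resolve_right hdi.ne'
        · have h3 := (Finset.sum_eq_zero_iff_of_nonpos fun l hl =>
            mul_nonpos_of_nonpos_of_nonneg (h.le l) (hb l hl)).1 h1.symm i i.2
          exact (mul_eq_zero.1 h3).resolve_right hdi.ne'
      rw [hg, ← Finset.sum_coe_sort b.support fun l => g l • P.root l]
      simp [Finsupp.single_apply, h2]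
  have hall := hsum univ b.support Subset.rfl (by simp) (fun i hi => absurd i.2 hi)
  have hdsum : ∀ g : ι → ℤ, (∀ j, g (P.reflectionPerm j j) = g j) →
      ∑ j, g j = ∑ j with d j = 0, g j + 2 * ∑ j with d j = 1, g j := by
    intro g hg
    have h1 : ∑ j with d j = -1, g j = ∑ j with d j = 1, g j := by
      have hs : ∀ j, P.reflectionPerm (P.reflectionPerm j j) (P.reflectionPerm j j) = j := by
        intro j
        apply P.root.injective
        rw [root_reflectionPerm, reflection_apply_self, root_reflectionPerm,
          reflection_apply_self, neg_neg]
      refine Finset.sum_nbij' (fun j => P.reflectionPerm j j) (fun j => P.reflectionPerm j j)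
        ?_ ?_ (fun j _ => hs j) (fun j _ => hs j) (fun j _ => (hg j).symm)
      all_goals
        intro j hj
        simp only [mem_filter, mem_univ, true_and, degree_reflectionPerm hd,
          pairingIn_same] at hj ⊢
        omega
    rw [two_mul, ← add_assoc]
    nth_rewrite 2 [← h1]
    simp only [Finset.sum_filter, ← Finset.sum_add_distrib]
    refine Finset.sum_congr rfl fun j _ => ?_
    have := abs_le.1 (hd1 j)
    obtain h | h | h : d j = -1 ∨ d j = 0 ∨ d j = 1 := by omega
    all_goals simp [h]
  have hcard := hdsum (fun _ => 1) (fun _ => rfl)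
  simp only [Finset.sum_const, nsmul_eq_mul, mul_one, Finset.card_univ] at hcard
  simp only [htotal, Finset.sum_const, nsmul_eq_mul, Finset.card_univ] at hall
  have hsupp : #b.support = #{i ∈ b.support | d i = 0} + #{i ∈ b.support | d i = 1} := by
    simp only [Finset.card_filter, ← Finset.sum_add_distrib]
    rw [Finset.card_eq_sum_ones]
    refine Finset.sum_congr rfl fun l hl => ?_
    have h2 := hb l hl
    have h3 := (abs_le.1 (hd1 l)).2
    split_ifs <;> omega
  have hmain : ∑ i ∈ b.support with d i = 0, ∑ j, P.pairingIn ℤ i j * P.pairingIn ℤ j i =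
      4 * (#{j | d j = 0} : ℤ) + 4 * ∑ i ∈ b.support with d i = 0,
        (#{j | d j = 1 ∧ P.root j - P.root i ∈ Set.range P.root} : ℤ) := by
    rw [← hzero, Finset.mul_sum, ← Finset.sum_add_distrib]
    refine Finset.sum_congr rfl fun i hi => ?_
    rw [hdsum _ (by simp), sum_degree_one_pairingIn_mul_pairingIn hd hd1 (mem_filter.1 hi).2]
    ring
  simp only [htotal, Finset.sum_const, nsmul_eq_mul] at hmain
  rw [hsupp, hone] at hall
  push_cast at hall
  zify
  linarith

end Degree

end RootPairing

namespace GradedLieAlgebra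

open LieAlgebra IsKilling DirectSum

/-! ### The grading element -/

section Euler

variable {k L : Type*} [Field k] [CharZero k] [LieRing L] [LieAlgebra k L]
  (𝒢 : ℤ → Submodule k L) [GradedLieAlgebra 𝒢]

omit [CharZero k] in
/-- The grading of a finite-dimensional Killing Lie algebra is given by an element of any Cartan
subalgebra contained in the component of degree `0`. -/
lemma exists_forall_lie_eq_smul [FiniteDimensional k L] [IsKilling k L]
    (H : LieSubalgebra k L) [H.IsCartanSubalgebra] (hH : H.toSubmodule ≤ 𝒢 0) :
    ∃ z : H, ∀ i, ∀ x ∈ 𝒢 i, ⁅(z : L), x⁆ = (i : k) • x := by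
  -- The derivation acting by `i` on `𝒢 i` is inner. Its element centralizes `H ≤ 𝒢 0`, hence lies
  -- in the zero root space, which is `H`.
  obtain ⟨z, hz⟩ := LieDerivation.IsKilling.exists_eq_ad
    (LieDerivation.ofGrading 𝒢 (Int.castAddHom k))
  have hz' : ∀ i, ∀ x ∈ 𝒢 i, ⁅z, x⁆ = (i : k) • x := by
    intro i x hx
    rw [← LieDerivation.ad_apply_apply (R := k), hz, LieDerivation.ofGrading_apply_apply _ _ hx]
    rfl
  have hzH : z ∈ rootSpace H (0 : H → k) := by
    refine LieModule.weightSpace_le_genWeightSpace L (0 : H → k) ?_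
    rw [LieModule.mem_weightSpace]
    intro y
    have := hz' 0 y (hH y.2)
    rw [Int.cast_zero, zero_smul] at this
    rw [Pi.zero_apply, zero_smul, LieSubalgebra.coe_bracket_of_module, ← lie_skew, this, neg_zero]
  rw [LieAlgebra.rootSpace_zero_eq] at hzH
  exact ⟨⟨z, hzH⟩, hz'⟩

variable {𝒢} {z : L}

omit [CharZero k] in
lemma decompose_lie_apply (hz : ∀ i, ∀ x ∈ 𝒢 i, ⁅z, x⁆ = (i : k) • x) (x : L) (i : ℤ) :
    (decompose 𝒢 ⁅z, x⁆ i : L) = (i : k) • (decompose 𝒢 x i : L) := by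
  induction x using DirectSum.Decomposition.inductionOn 𝒢 with
  | zero => simp
  | @homogeneous j m =>
    rw [hz j m m.2, decompose_smul, decompose_coe, DirectSum.smul_apply, Submodule.coe_smul]
    by_cases h : j = i
    · subst h
      rfl
    · rw [DirectSum.of_eq_of_ne _ _ _ (Ne.symm h)]
      simp
  | add m m' h h' =>
    simp only [lie_add, decompose_add, DirectSum.add_apply, Submodule.coe_add, h, h', smul_add]

omit [CharZero k] in
lemma eq_of_decompose_ne_zero (hz : ∀ i, ∀ x ∈ 𝒢 i, ⁅z, x⁆ = (i : k) • x) {x : L} {c : k}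
    (hx : ⁅z, x⁆ = c • x) {i : ℤ} (hi : (decompose 𝒢 x i : L) ≠ 0) : c = i := by
  have h := decompose_lie_apply hz x i
  rw [hx, decompose_smul, DirectSum.smul_apply, Submodule.coe_smul] at h
  exact smul_left_injective k hi h

lemma mem_of_lie_eq_smul (hz : ∀ i, ∀ x ∈ 𝒢 i, ⁅z, x⁆ = (i : k) • x) {x : L} {i : ℤ}
    (hx : ⁅z, x⁆ = (i : k) • x) : x ∈ 𝒢 i := by
  classical
  rw [← DirectSum.sum_support_decompose 𝒢 x]
  refine Submodule.sum_mem _ fun j hj => ?_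
  have hj : (decompose 𝒢 x j : L) ≠ 0 := by simpa using hj
  have : (i : k) = j := eq_of_decompose_ne_zero hz hx hj
  rw [Int.cast_injective this]
  exact (decompose 𝒢 x j).2

omit [CharZero k] in
lemma exists_eq_intCast_of_lie_eq_smul (hz : ∀ i, ∀ x ∈ 𝒢 i, ⁅z, x⁆ = (i : k) • x) {x : L}
    (hx0 : x ≠ 0) {c : k} (hx : ⁅z, x⁆ = c • x) : ∃ i : ℤ, c = i ∧ 𝒢 i ≠ ⊥ := by
  classical
  have : ∃ i, (decompose 𝒢 x i : L) ≠ 0 := by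
    by_contra! h
    apply hx0
    rw [← DirectSum.sum_support_decompose 𝒢 x]
    exact Finset.sum_eq_zero fun j _ => h j
  obtain ⟨i, hi⟩ := this
  exact ⟨i, eq_of_decompose_ne_zero hz hx hi,
    fun h => hi ((Submodule.mem_bot k).1 (h ▸ (decompose 𝒢 x i).2))⟩

omit [CharZero k] [GradedLieAlgebra 𝒢] in
lemma apply_eq_of_mem_weightSet {H : LieSubalgebra k L} {z : H}
    (hz : ∀ i, ∀ x ∈ 𝒢 i, ⁅(z : L), x⁆ = (i : k) • x)
    {i : ℤ} {χ : Module.Dual k H} (h : χ ∈ weightSet H (𝒢 i)) : χ z = i := by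
  obtain ⟨x, hx, hx0, hχ⟩ := h
  have h1 := hχ z
  rw [hz i x hx] at h1
  exact (smul_left_injective k hx0 h1).symm

end Euler

/-! ### Roots and weights of the graded components -/

section Roots

variable {k L : Type*} [Field k] [CharZero k] [IsAlgClosed k] [LieRing L] [LieAlgebra k L]
  [FiniteDimensional k L] [IsKilling k L] {𝒢 : ℤ → Submodule k L} [GradedLieAlgebra 𝒢]
  {H : LieSubalgebra k L} [H.IsCartanSubalgebra] {z : H}

lemma exists_ne_zero_forall_lie_eq_root_smul (α : H.root) :
    ∃ x ∈ rootSpace H (α : H → k), x ≠ 0 ∧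
      ∀ y : H, ⁅(y : L), x⁆ = (rootSystem H).root α y • x := by
  obtain ⟨x, hx, hx0⟩ := (α : LieModule.Weight k H L).exists_ne_zero
  exact ⟨x, hx, hx0, fun y => lie_eq_smul_of_mem_rootSpace hx y⟩

lemma root_mem_weightSet_iff (hz : ∀ i, ∀ x ∈ 𝒢 i, ⁅(z : L), x⁆ = (i : k) • x) {i : ℤ}
    (α : H.root) :
    (rootSystem H).root α ∈ weightSet H (𝒢 i) ↔ (rootSystem H).root α z = i := by
  refine ⟨apply_eq_of_mem_weightSet hz, fun h => ?_⟩
  obtain ⟨x, -, hx0, hx⟩ := exists_ne_zero_forall_lie_eq_root_smul α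
  exact ⟨x, mem_of_lie_eq_smul hz (by rw [hx z, h]), hx0, hx⟩

lemma exists_root_eq_of_mem_weightSet {V : Submodule k L} {χ : Module.Dual k H}
    (h : χ ∈ weightSet H V) (hχ : χ ≠ 0) : ∃ α : H.root, (rootSystem H).root α = χ := by
  obtain ⟨x, -, hx0, hx⟩ := h
  have hmem : x ∈ rootSpace H χ := by
    refine LieModule.weightSpace_le_genWeightSpace L (χ : H → k) ?_
    rw [LieModule.mem_weightSpace]
    exact hx
  let α : LieModule.Weight k H L :=
    ⟨χ, fun h => hx0 (by rw [show rootSpace H χ = ⊥ from h] at hmem; simpa using hmem)⟩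
  refine ⟨⟨α, ?_⟩, ?_⟩
  · simp only [Finset.mem_filter, Finset.mem_univ, true_and]
    intro h
    apply hχ
    ext y
    exact congrFun h y
  · ext y
    rfl

/-- The dimension of a component of nonzero degree is the number of roots of that degree. -/
lemma finrank_eq_card_roots (hz : ∀ i, ∀ x ∈ 𝒢 i, ⁅(z : L), x⁆ = (i : k) • x) {i : ℤ}
    (hi : i ≠ 0) (s : Finset H.root) (hs : ∀ α, α ∈ s ↔ (rootSystem H).root α z = i) :
    Module.finrank k (𝒢 i) = s.card := by
  choose x hx hx0 hxα using exists_ne_zero_forall_lie_eq_root_smul (k := k) (H := H)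
  have hli : LinearIndependent k fun α : s => x α := by
    have h1 := (LieSubmodule.iSupIndep_toSubmodule.2
      (LieModule.iSupIndep_genWeightSpace' k H L)).comp
        (Subtype.val_injective.comp (Subtype.val_injective (p := (· ∈ s))))
    exact h1.linearIndependent _ (fun α => hx α) (fun α => hx0 α)
  have hspan : 𝒢 i = Submodule.span k (Set.range fun α : s => x α) := by
    apply le_antisymm
    -- As an `H`-submodule, `𝒢 i` is the sum of its intersections with the root spaces, which are
    -- lines because `i ≠ 0` excludes the zero weight.
    · let N : LieSubmodule k H L :=
        { 𝒢 i with
          lie_mem := by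
            intro y m hm
            refine mem_of_lie_eq_smul hz ?_
            rw [LieSubalgebra.coe_bracket_of_module, leibniz_lie, hz i m hm]
            have : ⁅(z : L), (y : L)⁆ = 0 := by
              have := LieModule.IsTrivial.trivial (z : H) (y : H)
              simpa using congrArg (Subtype.val) this
            rw [this, zero_lie, zero_add, lie_smul] }
      have hN : N.toSubmodule = 𝒢 i := rfl
      rw [← hN, LieModule.eq_iSup_inf_genWeightSpace (K := k) (L := H) (M := L) N, LieSubmodule.iSup_toSubmodule, iSup_le_iff]
      rintro χ y ⟨hy, hyχ⟩
      by_cases hy0 : y = 0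
      · rw [hy0]
        exact Submodule.zero_mem _
      have hyL : ∀ h : H, ⁅(h : L), y⁆ = χ h • y := lie_eq_smul_of_mem_rootSpace hyχ
      have hχz : χ z = i := by
        have h1 := hyL z
        rw [hz i y hy] at h1
        exact (smul_left_injective k hy0 h1).symm
      have hχ : χ.IsNonZero := by
        intro h
        have h1 : χ z = 0 := congrFun h z
        rw [hχz] at h1
        exact hi (by exact_mod_cast h1)
      let α : H.root := ⟨χ, by simpa using hχ⟩
      have hα : α ∈ s := (hs α).2 hχz
      obtain ⟨c, hc⟩ := (finrank_eq_one_iff_of_nonzero' (⟨x α, hx α⟩ : rootSpace H χ)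
        (fun h => hx0 α (congrArg Subtype.val h))).1 (finrank_rootSpace_eq_one χ hχ) ⟨y, hyχ⟩
      have hc : c • x α = y := congrArg Subtype.val hc
      rw [← hc]
      exact Submodule.smul_mem _ _ (Submodule.subset_span ⟨⟨α, hα⟩, rfl⟩)
    · rw [Submodule.span_le]
      rintro - ⟨α, rfl⟩
      exact mem_of_lie_eq_smul hz (by rw [hxα, (hs α).1 α.2])
  rw [hspan, finrank_span_eq_card hli, Fintype.card_coe]

end Roots

end GradedLieAlgebra

/-! ### Hasse edges as pairs of roots -/

section Edges

open LieAlgebra IsKilling GradedLieAlgebra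

variable {k L : Type*} [Field k] [IsAlgClosed k] [CharZero k]
    [LieRing L] [LieAlgebra k L] [FiniteDimensional k L] [LieAlgebra.IsSimple k L]
    {𝒢 : ℤ → Submodule k L} [GradedLieAlgebra 𝒢]
    {H : LieSubalgebra k L} [H.IsCartanSubalgebra]

-- An edge `(μ, ν)` is determined by its label `μ - ν = αᵢ ∈ Π(0)` and its top `μ = αⱼ`; the
-- bijection sends `(i, j)` to `(αⱼ, αⱼ - αᵢ)`.
open Classical in
lemma ncard_gradingEdges_one {z : H} (hz : ∀ i, ∀ x ∈ 𝒢 i, ⁅(z : L), x⁆ = (i : k) • x)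
    (b : (rootSystem H).Base) {d : H.root → ℤ} (hd : ∀ α, (rootSystem H).root α z = d α) :
    (gradingEdges 𝒢 H b 1).ncard = ∑ i ∈ b.support with d i = 0,
      Finset.card {j | d j = 1 ∧
        (rootSystem H).root j - (rootSystem H).root i ∈ Set.range (rootSystem H).root} := by
  have hmem : ∀ (n : ℤ) (α : H.root), (rootSystem H).root α ∈ weightSet H (𝒢 n) ↔ d α = n := by
    intro n α
    rw [root_mem_weightSet_iff hz, hd]
    exact_mod_cast Iff.rfl
  have hS : ∀ χ, χ ∈ simpleRootsZero 𝒢 H b ↔ ∃ i ∈ b.support, d i = 0 ∧ (rootSystem H).root i = χ := by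
    intro χ
    constructor
    · rintro ⟨⟨i, hi, rfl⟩, h⟩
      exact ⟨i, hi, (hmem 0 i).1 h, rfl⟩
    · rintro ⟨i, hi, h, rfl⟩
      exact ⟨⟨i, hi, rfl⟩, (hmem 0 i).2 h⟩
  have hedge : ∀ μ ν : weightSet H (𝒢 1), (μ, ν) ∈ gradingEdges 𝒢 H b 1 ↔
      (μ : Module.Dual k H) - ν ∈ simpleRootsZero 𝒢 H b := by
    intro μ ν
    -- The additive function is the height, equal to `1` on each simple root.
    refine mem_hasseEdges_rootLE_iff _ _
      (b.toWeightBasis.constr k fun _ => (1 : k)).toAddMonoidHom ?_ μ ν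
    intro α hα
    obtain ⟨i, hi, -, rfl⟩ := (hS α).1 hα
    have := b.toWeightBasis.constr_basis k (fun _ => (1 : k)) ⟨i, hi⟩
    rwa [RootPairing.Base.toWeightBasis_apply] at this
  have hroot : ∀ μ : weightSet H (𝒢 1), ∃ j, d j = 1 ∧ (rootSystem H).root j = μ := by
    intro μ
    have h1 := apply_eq_of_mem_weightSet hz μ.2
    obtain ⟨j, hj⟩ := exists_root_eq_of_mem_weightSet μ.2 (by
      intro h
      rw [h] at h1
      simp at h1)
    exact ⟨j, (hmem 1 j).1 (hj ▸ μ.2), hj⟩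
  have hsub : ∀ i j l, d i = 0 → d j = 1 → (rootSystem H).root l = (rootSystem H).root j - (rootSystem H).root i → d l = 1 := by
    intro i j l hi hj hl
    have := congrArg (fun χ : Module.Dual k H => χ z) hl
    simp only [LinearMap.sub_apply, hd, hi, hj] at this
    exact_mod_cast this
  rw [← Finset.card_sigma, ← Set.ncard_coe_finset]
  symm
  have hT : ∀ p : (_ : H.root) × H.root, p ∈ ((b.support.filter fun i => d i = 0).sigma fun i =>
      Finset.univ.filter fun j => d j = 1 ∧ (rootSystem H).root j - (rootSystem H).root i ∈ Set.range (rootSystem H).root) →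
      (p.1 ∈ b.support ∧ d p.1 = 0) ∧ d p.2 = 1 ∧ (rootSystem H).root p.2 ∈ weightSet H (𝒢 1) ∧
        (rootSystem H).root p.2 - (rootSystem H).root p.1 ∈ weightSet H (𝒢 1) := by
    rintro ⟨i, j⟩ h
    simp only [Finset.mem_sigma, Finset.mem_filter, Finset.mem_univ, true_and] at h ⊢
    obtain ⟨hi, hj, l, hl⟩ := h
    exact ⟨hi, hj, (hmem 1 j).2 hj, hl ▸ (hmem 1 l).2 (hsub i j l hi.2 hj hl)⟩
  refine Set.ncard_congr
    (fun p hp => (⟨_, (hT p hp).2.2.1⟩, ⟨_, (hT p hp).2.2.2⟩)) ?_ ?_ ?_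
  · intro p hp
    rw [hedge, hS]
    obtain ⟨⟨h1, h2⟩, -⟩ := hT p hp
    exact ⟨p.1, h1, h2, by simp⟩
  · rintro ⟨i, j⟩ ⟨i', j'⟩ hp hp' h
    simp only [Prod.mk.injEq, Subtype.mk.injEq] at h
    obtain rfl := (rootSystem H).root.injective h.1
    obtain rfl := (rootSystem H).root.injective (sub_right_injective h.2)
    rfl
  · rintro ⟨μ, ν⟩ h
    obtain ⟨i, hi, hi0, hiμ⟩ := (hS _).1 ((hedge μ ν).1 h)
    obtain ⟨j, hj, hjμ⟩ := hroot μ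
    obtain ⟨l, -, hlν⟩ := hroot ν
    refine ⟨⟨i, j⟩, ?_, ?_⟩
    · simp only [Finset.coe_sigma, Set.mem_sigma_iff, Finset.mem_coe, Finset.mem_filter,
        Finset.mem_univ, true_and]
      exact ⟨⟨hi, hi0⟩, hj, l, by rw [hlν, hjμ, hiμ]; abel⟩
    · refine Prod.ext (Subtype.ext hjμ) (Subtype.ext ?_)
      change (rootSystem H).root j - (rootSystem H).root i = ν
      rw [hjμ, hiμ]
      abel

end Edges

theorem mainTheorem6 {k L : Type*} [Field k] [IsAlgClosed k] [CharZero k]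
    [LieRing L] [LieAlgebra k L] [FiniteDimensional k L] [LieAlgebra.IsSimple k L]
    (𝒢 : ℤ → Submodule k L) [GradedLieAlgebra 𝒢] (hshort : IsShortGrading 𝒢)
    (H : LieSubalgebra k L) [H.IsCartanSubalgebra] (hH : H.toSubmodule ≤ 𝒢 0)
    (b : (LieAlgebra.IsKilling.rootSystem H).Base)
    (hb : ∀ α ∈ b.support, ∃ n : ℕ,
      (LieAlgebra.IsKilling.rootSystem H).root α ∈ weightSet H (𝒢 (n : ℤ))) :
    2 * (Module.finrank k (𝒢 1) : ℤ) - ((gradingEdges 𝒢 H b 1).ncard : ℤ) =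
      (coxeterNumber b : ℤ) := by
  classical
  obtain ⟨z, hz⟩ := GradedLieAlgebra.exists_forall_lie_eq_smul 𝒢 H hH
  have hdeg : ∀ α : H.root, ∃ n : ℤ, (LieAlgebra.IsKilling.rootSystem H).root α z = n ∧
      |n| ≤ 1 := by
    intro α
    obtain ⟨x, -, hx0, hx⟩ := GradedLieAlgebra.exists_ne_zero_forall_lie_eq_root_smul α
    obtain ⟨n, hn, hn0⟩ := GradedLieAlgebra.exists_eq_intCast_of_lie_eq_smul hz hx0 (hx z)
    refine ⟨n, hn, ?_⟩
    obtain h | h | h := hshort.2 n hn0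
    all_goals simp [h]
  choose d hd hd1 using hdeg
  have hfin : Module.finrank k (𝒢 1) = Finset.card {j | d j = 1} := by
    refine GradedLieAlgebra.finrank_eq_card_roots hz one_ne_zero _ fun α => ?_
    rw [hd]
    simp
  have hne : ∃ j, d j = 1 := by
    have h1 : Module.finrank k (𝒢 1) ≠ 0 := fun h => hshort.1 (Submodule.finrank_eq_zero.1 h)
    rw [hfin, Finset.card_ne_zero] at h1
    obtain ⟨j, hj⟩ := h1
    exact ⟨j, (Finset.mem_filter.1 hj).2⟩
  have hb' : ∀ i ∈ b.support, 0 ≤ d i := by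
    intro i hi
    obtain ⟨n, hn⟩ := hb i hi
    have := GradedLieAlgebra.apply_eq_of_mem_weightSet hz hn
    rw [hd] at this
    rw [Int.cast_injective this]
    exact Int.natCast_nonneg n
  have key := b.sum_card_add_coxeterNumber (f := Module.Dual.eval k H z) hd hd1 hb' hne
  rw [← ncard_gradingEdges_one hz b hd, ← hfin] at key
  omega
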